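/- Let $X\subset\mathbb{R}^2$ be open, let $f:X\to\mathbb{R}$ be locally Lipschitz continuous, and let $x\in X$. For a function $g$ defined near a point $y$, write $g'(y;d):=\lim_{t\downarrow 0}\frac{g(y+td)-g(y)}{t}$ when this limit exists in $\mathbb{R}$; $g$ is directionally differentiable at $y$ if $g'(y;d)$ exists for every $d\in\mathbb{R}^2$. If $f$ is directionally differentiable at $x$, its compass difference at $x$ is $$\Delta^{\oplus} f(x):=\tfrac12\big(f'(x;e_1)-f'(x;-e_1),\ f'(x;e_2)-f'(x;-e_2)\big)\in\mathbb{R}^2,$$ where $e_1,e_2$ are the unit coordinate vectors. Clarke's generalized gradient of $f$ at $x$ is $$\partial f(x):=\{s\in\mathbb{R}^2:\ \langle s,d\rangle\le f^\circ(x;d)\ \ \forall d\in\mathbb{R}^2\},\qquad f^\circ(x;d):=\limsup_{y\to x,\ t\downarrow 0}\frac{f(y+td)-f(y)}{t}.$$ The function $f$ is lexicographically smooth (L-smooth) at $x$ if it is directionally differentiable at $x$ and, for all $m_1,m_2\in\mathbb{R}^2$, the functions $f^{(0)}:=f'(x;\cdot)$, $f^{(1)}:=[f^{(0)}]'(m_1;\cdot)$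 and $f^{(2)}:=[f^{(1)}]'(m_2;\cdot)$ are well defined on all of $\mathbb{R}^2$. If $m_1,m_2$ are linearly independent, then $f^{(2)}$ is linear; the lexicographic subdifferential $\partial_L f(x)$ is the set of all $s\in\mathbb{R}^2$ such that $f^{(2)}=\langle s,\cdot\rangle$ for some linearly independent $m_1,m_2$. (a) If $f$ is directionally differentiable at $x$, then $\Delta^{\oplus} f(x)\in\partial f(x)$. (b) If $f$ is L-smooth at $x$, then $\Delta^{\oplus} f(x)\in\overline{\mathrm{conv}}\,\partial_L f(x)\subset\partial f(x)$, where $\overline{\mathrm{conv}}$ denotes the closed convex hull. -/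

import Mathlib

open Filter Topology

noncomputable section

/-- `l` is the one-sided directional derivative of `f` at `x` in the direction `d`:
`l = lim_{t ↓ 0} (f (x + t d) - f x) / t`. -/
def HasDirDeriv {n : ℕ} (f : EuclideanSpace ℝ (Fin n) → ℝ) (x d : EuclideanSpace ℝ (Fin n))
    (l : ℝ) : Prop :=
  Tendsto (fun t : ℝ => (f (x + t • d) - f x) / t) (𝓝[>] 0) (𝓝 l)

/-- `f` is directionally differentiable at `x`: the one-sided directional derivative exists in `ℝ`
for every direction. -/
def DirDifferentiableAt {n : ℕ} (f : EuclideanSpace ℝ (Fin n) → ℝ)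
    (x : EuclideanSpace ℝ (Fin n)) : Prop :=
  ∀ d, ∃ l, HasDirDeriv f x d l

/-- The one-sided directional derivative `f'(x; d)` (an unspecified number if the limit
does not exist). -/
def dirDeriv {n : ℕ} (f : EuclideanSpace ℝ (Fin n) → ℝ) (x d : EuclideanSpace ℝ (Fin n)) : ℝ :=
  limUnder (𝓝[>] (0 : ℝ)) (fun t : ℝ => (f (x + t • d) - f x) / t)

theorem HasDirDeriv.dirDeriv_eq {n : ℕ} {f : EuclideanSpace ℝ (Fin n) → ℝ}
    {x d : EuclideanSpace ℝ (Fin n)} {l : ℝ} (h : HasDirDeriv f x d l) : dirDeriv f x d = l :=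
  Tendsto.limUnder_eq h

/-- The compass difference of `f` at `x`: the vector whose `i`-th component is
`(f'(x; e_i) - f'(x; -e_i)) / 2`. -/
def compassDifference {n : ℕ} (f : EuclideanSpace ℝ (Fin n) → ℝ)
    (x : EuclideanSpace ℝ (Fin n)) : EuclideanSpace ℝ (Fin n) :=
  WithLp.toLp 2 fun i : Fin n =>
    (1 / 2 : ℝ) * (dirDeriv f x (EuclideanSpace.single i 1)
      - dirDeriv f x (-EuclideanSpace.single i 1))

/-- Clarke's generalized directional derivative
`f°(x; d) = limsup_{y → x, t ↓ 0} (f (y + t d) - f y) / t`. The difference quotients are bounded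
near `(x, 0)` whenever `f` is Lipschitz near `x`, so that the real-valued `limsup` is then the
usual one. -/
def clarkeDirDeriv {n : ℕ} (f : EuclideanSpace ℝ (Fin n) → ℝ)
    (x d : EuclideanSpace ℝ (Fin n)) : ℝ :=
  limsup (fun p : EuclideanSpace ℝ (Fin n) × ℝ => (f (p.1 + p.2 • d) - f p.1) / p.2)
    (𝓝 x ×ˢ 𝓝[>] (0 : ℝ))

/-- Clarke's generalized gradient of `f` at `x`. -/
def clarkeGradient {n : ℕ} (f : EuclideanSpace ℝ (Fin n) → ℝ)
    (x : EuclideanSpace ℝ (Fin n)) : Set (EuclideanSpace ℝ (Fin n)) :=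
  {s | ∀ d, inner ℝ s d ≤ clarkeDirDeriv f x d}

/-- `F 0, F 1, …, F n` is the (uniquely determined) sequence of higher-order directional
derivatives of `f` at `x` along `m`: `F 0 = f'(x; ·)` and `F k = [F (k-1)]'(m_k; ·)` for
`k = 1, …, n`, all these limits existing in every direction. (The vectors `m_1, …, m_n` are
indexed from `0` here.) -/
def IsLexSequence {n : ℕ} (f : EuclideanSpace ℝ (Fin n) → ℝ) (x : EuclideanSpace ℝ (Fin n))
    (m : Fin n → EuclideanSpace ℝ (Fin n))
    (F : Fin (n + 1) → EuclideanSpace ℝ (Fin n) → ℝ) : Prop :=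
  (∀ d, HasDirDeriv f x d (F 0 d)) ∧
    ∀ k : Fin n, ∀ d, HasDirDeriv (F k.castSucc) (m k) d (F k.succ d)

/-- Lexicographic smoothness at `x` of a function `f` that is locally Lipschitz: `f` is
directionally differentiable at `x`, and for any `m_1, …, m_n` the sequence of higher-order
directional derivatives along them is well defined. -/
def LexSmoothAt {n : ℕ} (f : EuclideanSpace ℝ (Fin n) → ℝ)
    (x : EuclideanSpace ℝ (Fin n)) : Prop :=
  DirDifferentiableAt f x ∧
    ∀ m : Fin n → EuclideanSpace ℝ (Fin n), ∃ F, IsLexSequence f x m F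

/-- The lexicographic subdifferential of `f` at `x`: the gradients `s` of the linear functions
`F n = ⟨s, ·⟩`, for linearly independent `m_1, …, m_n`. -/
def lexSubdifferential {n : ℕ} (f : EuclideanSpace ℝ (Fin n) → ℝ)
    (x : EuclideanSpace ℝ (Fin n)) : Set (EuclideanSpace ℝ (Fin n)) :=
  {s | ∃ m : Fin n → EuclideanSpace ℝ (Fin n), LinearIndependent ℝ m ∧
    ∃ F, IsLexSequence f x m F ∧ ∀ d, F (Fin.last n) d = inner ℝ s d}

end

/-! ### Calculus of one-sided directional derivatives. -/

namespace HasDirDeriv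

variable {n : ℕ} {f : EuclideanSpace ℝ (Fin n) → ℝ} {x d y : EuclideanSpace ℝ (Fin n)} {l l' : ℝ}

/-! Write `φ = f'(x; ·)`. In the plane, a bound `φ (y + d) - φ y ≤ C` for all `y` forces `⟨Δ, d⟩ ≤
C` for the compass difference `Δ`: split `d = v + w` along the axes, so that `2⟨Δ, d⟩ = (φ v - φ
(-w)) + (φ w - φ (-v))`, a sum of two increments of `φ` along `d` (`inner_compassDifference_le`).

For (a), take `C = f°(x; d)`, which bounds such increments. For (b), separate `Δ` from the closed
convex hull by some `d`. The derivative of `φ` at `m` along `d`, with `m, d` independent, is `⟨s,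
d⟩` for a lexicographic subgradient `s`, so a mean value inequality bounds the increments by any
bound for `⟨s, d⟩` over all such `s`. This contradicts the separation. -/

theorem unique (h : HasDirDeriv f x d l) (h' : HasDirDeriv f x d l') : l = l' :=
  tendsto_nhds_unique h h'

theorem zero_dir (f : EuclideanSpace ℝ (Fin n) → ℝ) (x : EuclideanSpace ℝ (Fin n)) :
    HasDirDeriv f x 0 0 := by
  simp [HasDirDeriv]

theorem smul_dir (h : HasDirDeriv f x d l) {c : ℝ} (hc : 0 < c) :
    HasDirDeriv f x (c • d) (c * l) := by
  have hτ : Tendsto (fun t : ℝ => t * c) (𝓝[>] 0) (𝓝[>] 0) := by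
    refine tendsto_nhdsWithin_iff.2 ⟨?_, ?_⟩
    · have : Tendsto (fun t : ℝ => t * c) (𝓝 0) (𝓝 (0 * c)) :=
        Continuous.tendsto (by fun_prop) 0
      rw [zero_mul] at this
      exact this.mono_left nhdsWithin_le_nhds
    · filter_upwards [self_mem_nhdsWithin] with t ht
      exact mul_pos ht hc
  refine ((Tendsto.comp h hτ).const_mul c).congr' ?_
  filter_upwards [self_mem_nhdsWithin] with t (ht : 0 < t)
  simp only [Function.comp_apply, smul_smul]
  field_simp

/-- Directional derivatives of a positively homogeneous function at `x` are affine along `x`. -/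
theorem add_smul_base (hf : ∀ (c : ℝ) z, 0 < c → f (c • z) = c * f z) (h : HasDirDeriv f x d l)
    (c : ℝ) : HasDirDeriv f x (d + c • x) (l + c * f x) := by
  have hone : Tendsto (fun t : ℝ => 1 + t * c) (𝓝[>] 0) (𝓝 1) := by
    have : Tendsto (fun t : ℝ => 1 + t * c) (𝓝 0) (𝓝 (1 + 0 * c)) :=
      Continuous.tendsto (by fun_prop) 0
    rw [zero_mul, add_zero] at this
    exact this.mono_left nhdsWithin_le_nhds
  have hpos : ∀ᶠ t : ℝ in 𝓝[>] 0, 0 < 1 + t * c := hone.eventually (lt_mem_nhds one_pos)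
  -- Homogeneity lets `1 + t * c` be factored out of `x + t • (d + c • x)`, leaving the quotient
  -- along `d` with step `t / (1 + t * c)`.
  have hτ : Tendsto (fun t : ℝ => t / (1 + t * c)) (𝓝[>] 0) (𝓝[>] 0) := by
    refine tendsto_nhdsWithin_iff.2 ⟨?_, ?_⟩
    · have := (tendsto_id.mono_left (nhdsWithin_le_nhds (a := (0 : ℝ)) (s := Set.Ioi 0))).div
        hone one_ne_zero
      rwa [zero_div] at this
    · filter_upwards [self_mem_nhdsWithin, hpos] with t ht hp
      exact div_pos ht hp
  refine ((Tendsto.comp h hτ).add_const (c * f x)).congr' ?_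
  filter_upwards [self_mem_nhdsWithin, hpos] with t (ht : 0 < t) hp
  have hz : x + t • (d + c • x) = (1 + t * c) • (x + (t / (1 + t * c)) • d) := by
    rw [smul_add (1 + t * c), smul_smul, mul_div_cancel₀ _ hp.ne']
    module
  simp only [Function.comp_apply]
  rw [hz, hf _ _ hp]
  field_simp
  ring

/-- Directional derivatives inherit affineness along a direction. -/
theorem add_smul_of_affine {v : EuclideanSpace ℝ (Fin n)} {a : ℝ}
    (hf : ∀ z (c : ℝ), f (z + c • v) = f z + c * a) (h : HasDirDeriv f x d l) (c : ℝ) :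
    HasDirDeriv f x (d + c • v) (l + c * a) := by
  refine (Tendsto.add_const (c * a) h).congr' ?_
  filter_upwards [self_mem_nhdsWithin] with t (ht : 0 < t)
  rw [smul_add, smul_smul, ← add_assoc, hf]
  field_simp
  ring

theorem self_dir (hf : ∀ (c : ℝ) z, 0 < c → f (c • z) = c * f z) : HasDirDeriv f x x (f x) := by
  simpa using (zero_dir f x).add_smul_base hf 1

theorem sub_le {C : ℝ} (h : HasDirDeriv f x d l) (h' : HasDirDeriv f x y l')
    (hC : ∀ᶠ s : ℝ in 𝓝[>] 0, f (x + s • d) - f (x + s • y) ≤ s * C) : l - l' ≤ C := by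
  refine le_of_tendsto (Tendsto.sub h h') ?_
  filter_upwards [self_mem_nhdsWithin, hC] with s (hs : 0 < s) h
  rw [← sub_div, sub_sub_sub_cancel_right, div_le_iff₀ hs]
  linarith

/-- A mean value inequality for one-sided directional derivatives. -/
theorem image_sub_le {c : ℝ} (hf : Continuous f)
    (h : ∀ t : ℝ, ∃ l, HasDirDeriv f (y + t • d) d l ∧ l ≤ c) : f (y + d) - f y ≤ c := by
  choose g' hg hc using h
  have key := image_le_of_deriv_right_le_deriv_boundary (f := fun t : ℝ => f (y + t • d))
    (f' := g') (a := 0) (b := 1) (B := fun t => f y + t * c) (B' := fun _ => c)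
    (by fun_prop) ?_ (by simp) (by fun_prop) ?_ (fun t _ => hc t) (x := 1) (by simp)
  · simp only [one_smul, one_mul] at key
    linarith
  · intro t _
    rw [← hasDerivWithinAt_Ioi_iff_Ici, hasDerivWithinAt_iff_tendsto_slope' (by simp)]
    have hsub : Tendsto (fun τ : ℝ => τ - t) (𝓝[>] t) (𝓝[>] 0) := by
      refine tendsto_nhdsWithin_iff.2 ⟨?_, ?_⟩
      · have : Tendsto (fun τ : ℝ => τ - t) (𝓝 t) (𝓝 (t - t)) :=
          Continuous.tendsto (by fun_prop) t
        rw [sub_self] at this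
        exact this.mono_left nhdsWithin_le_nhds
      · filter_upwards [self_mem_nhdsWithin] with τ (hτ : t < τ)
        exact sub_pos.2 hτ
    refine (Tendsto.comp (hg t) hsub).congr fun τ => ?_
    rw [slope_def_field, Function.comp_apply, add_assoc, ← add_smul, add_sub_cancel]
  · intro t _
    exact (((hasDerivAt_id t).mul_const c).const_add (f y)).hasDerivWithinAt.congr_deriv (by simp)

end HasDirDeriv

/-! ### Clarke's derivative as a bound for increments. -/

section Clarke

variable {n : ℕ} {f : EuclideanSpace ℝ (Fin n) → ℝ} {x d : EuclideanSpace ℝ (Fin n)}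

theorem tendsto_add_smul_nhdsGT (x y : EuclideanSpace ℝ (Fin n)) :
    Tendsto (fun s : ℝ => x + s • y) (𝓝[>] 0) (𝓝 x) := by
  have : Tendsto (fun s : ℝ => x + s • y) (𝓝 0) (𝓝 (x + (0 : ℝ) • y)) :=
    Continuous.tendsto (by fun_prop) 0
  rw [zero_smul, add_zero] at this
  exact this.mono_left nhdsWithin_le_nhds

theorem isBoundedUnder_clarke_quotient {K : NNReal} {t : Set (EuclideanSpace ℝ (Fin n))}
    (ht : t ∈ 𝓝 x) (hf : LipschitzOnWith K f t) (d : EuclideanSpace ℝ (Fin n)) :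
    IsBoundedUnder (· ≤ ·) (𝓝 x ×ˢ 𝓝[>] (0 : ℝ))
      (fun p : EuclideanSpace ℝ (Fin n) × ℝ => (f (p.1 + p.2 • d) - f p.1) / p.2) := by
  refine ⟨K * ‖d‖, eventually_map.2 ?_⟩
  have h1 : Tendsto (fun p : EuclideanSpace ℝ (Fin n) × ℝ => p.1 + p.2 • d)
      (𝓝 x ×ˢ 𝓝[>] (0 : ℝ)) (𝓝 x) := by
    have : Tendsto (fun p : EuclideanSpace ℝ (Fin n) × ℝ => p.1 + p.2 • d)
        (𝓝 (x, 0)) (𝓝 (x + (0 : ℝ) • d)) :=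
      Continuous.tendsto (f := fun p : EuclideanSpace ℝ (Fin n) × ℝ => p.1 + p.2 • d)
        (by fun_prop) (x, 0)
    rw [zero_smul, add_zero, nhds_prod_eq] at this
    exact this.mono_left (prod_mono_right _ nhdsWithin_le_nhds)
  filter_upwards [h1 ht, tendsto_fst ht, tendsto_snd self_mem_nhdsWithin] with p hp hp1
    (hp2 : 0 < p.2)
  rw [div_le_iff₀ hp2]
  have := hf.dist_le_mul _ hp _ hp1
  rw [Real.dist_eq, dist_eq_norm, add_sub_cancel_left, norm_smul, Real.norm_of_nonneg hp2.le]
    at this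
  linarith [le_abs_self (f (p.1 + p.2 • d) - f p.1)]

theorem dirDeriv_sub_le_clarkeDirDeriv {K : NNReal} {u : Set (EuclideanSpace ℝ (Fin n))}
    (hu : u ∈ 𝓝 x) (hf : LipschitzOnWith K f u) {φ : EuclideanSpace ℝ (Fin n) → ℝ}
    (hφ : ∀ d, HasDirDeriv f x d (φ d)) (y d : EuclideanSpace ℝ (Fin n)) {t : ℝ} (ht : 0 < t) :
    φ (y + t • d) - φ y ≤ t * clarkeDirDeriv f x d := by
  rw [mul_comm, ← div_le_iff₀ ht]
  refine le_of_forall_gt_imp_ge_of_dense fun b hb => ?_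
  have hev := eventually_lt_of_limsup_lt hb (isBoundedUnder_clarke_quotient hu hf d)
  -- The increment of `f` from `x + s • y` to `x + s • (y + t • d)` is a Clarke quotient with moving
  -- base point and step `s * t`.
  have hpath : Tendsto (fun s : ℝ => (x + s • y, s * t)) (𝓝[>] 0) (𝓝 x ×ˢ 𝓝[>] (0 : ℝ)) := by
    refine (tendsto_add_smul_nhdsGT x y).prodMk (tendsto_nhdsWithin_iff.2 ⟨?_, ?_⟩)
    · have : Tendsto (fun s : ℝ => s * t) (𝓝 0) (𝓝 (0 * t)) :=
        Continuous.tendsto (by fun_prop) 0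
      rw [zero_mul] at this
      exact this.mono_left nhdsWithin_le_nhds
    · filter_upwards [self_mem_nhdsWithin] with s hs
      exact mul_pos hs ht
  rw [div_le_iff₀ ht]
  refine (hφ _).sub_le (hφ y) ?_
  filter_upwards [hpath.eventually hev, self_mem_nhdsWithin] with s h (hs : 0 < s)
  rw [div_lt_iff₀ (mul_pos hs ht), mul_smul, add_assoc, ← smul_add] at h
  linarith

theorem continuous_of_hasDirDeriv {K : NNReal} {u : Set (EuclideanSpace ℝ (Fin n))}
    (hu : u ∈ 𝓝 x) (hf : LipschitzOnWith K f u) {φ : EuclideanSpace ℝ (Fin n) → ℝ}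
    (hφ : ∀ d, HasDirDeriv f x d (φ d)) : Continuous φ := by
  refine (LipschitzWith.of_le_add_mul K fun y z => ?_).continuous
  rw [← sub_le_iff_le_add']
  refine (hφ y).sub_le (hφ z) ?_
  filter_upwards [tendsto_add_smul_nhdsGT x y hu, tendsto_add_smul_nhdsGT x z hu,
    self_mem_nhdsWithin] with s h1 h2 (hs : 0 < s)
  have := hf.dist_le_mul _ h1 _ h2
  rw [Real.dist_eq, dist_eq_norm, add_sub_add_left_eq_sub, ← smul_sub, norm_smul,
    Real.norm_of_nonneg hs.le, ← dist_eq_norm] at this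
  linarith [le_abs_self (f (x + s • y) - f (x + s • z))]

theorem convex_clarkeGradient : Convex ℝ (clarkeGradient f x) := by
  intro s hs t ht a b ha hb hab d
  rw [inner_add_left, real_inner_smul_left, real_inner_smul_left]
  calc a * inner ℝ s d + b * inner ℝ t d
      ≤ a * clarkeDirDeriv f x d + b * clarkeDirDeriv f x d := by
        gcongr
        exacts [hs d, ht d]
    _ = clarkeDirDeriv f x d := by rw [← add_mul, hab, one_mul]

theorem isClosed_clarkeGradient : IsClosed (clarkeGradient f x) := by
  simp only [clarkeGradient, Set.ofPred_forall]
  exact isClosed_iInter fun d => isClosed_le (by fun_prop) continuous_const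

theorem posHom_of_hasDirDeriv {φ : EuclideanSpace ℝ (Fin n) → ℝ}
    (hφ : ∀ d, HasDirDeriv f x d (φ d)) (c : ℝ) (z : EuclideanSpace ℝ (Fin n)) (hc : 0 < c) :
    φ (c • z) = c * φ z :=
  (hφ _).unique ((hφ z).smul_dir hc)

theorem zero_of_hasDirDeriv {φ : EuclideanSpace ℝ (Fin n) → ℝ}
    (hφ : ∀ d, HasDirDeriv f x d (φ d)) : φ 0 = 0 :=
  (hφ 0).unique (.zero_dir f x)

/-- Rescaling by `s` turns an increment along `t • d` into one along `(s * t) • d`, so the bound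
passes to each successive derivative. Started from Clarke's bound, it ends at `⟨s, d⟩ ≤ f°(x; d)`.
-/
theorem IsLexSequence.apply_add_sub_le {m : Fin n → EuclideanSpace ℝ (Fin n)}
    {F : Fin (n + 1) → EuclideanSpace ℝ (Fin n) → ℝ} (hF : IsLexSequence f x m F) {C : ℝ}
    (h0 : ∀ y (t : ℝ), 0 < t → F 0 (y + t • d) - F 0 y ≤ t * C) (k : Fin (n + 1)) :
    ∀ y (t : ℝ), 0 < t → F k (y + t • d) - F k y ≤ t * C := by
  induction k using Fin.induction with
  | zero => exact h0
  | succ k ih =>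
    intro y t ht
    refine (hF.2 k _).sub_le (hF.2 k y) ?_
    filter_upwards [self_mem_nhdsWithin] with s (hs : 0 < s)
    have := ih (m k + s • y) (s * t) (by positivity)
    rwa [add_assoc, mul_smul, ← smul_add, mul_assoc] at this

theorem lexSubdifferential_subset_clarkeGradient {K : NNReal}
    {u : Set (EuclideanSpace ℝ (Fin n))} (hu : u ∈ 𝓝 x) (hf : LipschitzOnWith K f u) :
    lexSubdifferential f x ⊆ clarkeGradient f x := by
  rintro s ⟨m, -, F, hF, hs⟩ d
  have := hF.apply_add_sub_le
    (fun y t ht => dirDeriv_sub_le_clarkeDirDeriv hu hf hF.1 y d ht) (Fin.last n) 0 1 one_pos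
  simpa [hs] using this

end Clarke

/-! ### The compass difference and lexicographic subgradients in the plane. -/

section Plane

variable {f : EuclideanSpace ℝ (Fin 2) → ℝ} {x : EuclideanSpace ℝ (Fin 2)}

theorem inner_compassDifference_le {φ : EuclideanSpace ℝ (Fin 2) → ℝ}
    (hφ : ∀ d, HasDirDeriv f x d (φ d)) {d : EuclideanSpace ℝ (Fin 2)} {C : ℝ}
    (hC : ∀ y, φ (y + d) - φ y ≤ C) : inner ℝ (compassDifference f x) d ≤ C := by
  -- The odd part of `φ` is homogeneous for scalars of either sign.
  have hodd (a : ℝ) (e : EuclideanSpace ℝ (Fin 2)) :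
      a * (φ e - φ (-e)) = φ (a • e) - φ (-(a • e)) := by
    rcases lt_trichotomy a 0 with ha | rfl | ha
    · have h1 := posHom_of_hasDirDeriv hφ (-a) e (by linarith)
      have h2 := posHom_of_hasDirDeriv hφ (-a) (-e) (by linarith)
      rw [neg_smul] at h1
      rw [smul_neg, neg_smul, neg_neg] at h2
      rw [h1, h2]
      ring
    · simp
    · rw [← smul_neg, posHom_of_hasDirDeriv hφ a _ ha, posHom_of_hasDirDeriv hφ a _ ha]
      ring
  set v := d 0 • (EuclideanSpace.single 0 1 : EuclideanSpace ℝ (Fin 2)) with hv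
  set w := d 1 • (EuclideanSpace.single 1 1 : EuclideanSpace ℝ (Fin 2)) with hw
  have hd : d = v + w := by
    ext i
    fin_cases i <;> simp [hv, hw]
  have h1 := hC (-w)
  have h2 := hC (-v)
  rw [hd, neg_add_eq_sub, add_sub_cancel_right] at h1
  rw [hd, neg_add_cancel_left] at h2
  have h3 := hodd (d 0) (EuclideanSpace.single 0 1)
  have h4 := hodd (d 1) (EuclideanSpace.single 1 1)
  simp only [compassDifference, (hφ _).dirDeriv_eq, PiLp.inner_apply, Fin.sum_univ_two,
    RCLike.inner_apply, conj_trivial]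
  linarith

/-- Each differentiation adds a direction of affineness: `m 0` at the first, kept at the second,
which adds `m 1`. Together with `F 2 0 = 0` this gives linearity. -/
theorem IsLexSequence.exists_inner {m : Fin 2 → EuclideanSpace ℝ (Fin 2)}
    (hm : LinearIndependent ℝ m) {F : Fin 3 → EuclideanSpace ℝ (Fin 2) → ℝ}
    (hF : IsLexSequence f x m F) : ∃ s, ∀ d, F 2 d = inner ℝ s d := by
  have h1 : ∀ d, HasDirDeriv (F 0) (m 0) d (F 1 d) := hF.2 0
  have h2 : ∀ d, HasDirDeriv (F 1) (m 1) d (F 2 d) := hF.2 1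
  have a1 (z) (c : ℝ) : F 1 (z + c • m 0) = F 1 z + c * F 0 (m 0) :=
    (h1 _).unique ((h1 z).add_smul_base (posHom_of_hasDirDeriv hF.1) c)
  have a2 (z) (c : ℝ) : F 2 (z + c • m 0) = F 2 z + c * F 0 (m 0) :=
    (h2 _).unique ((h2 z).add_smul_of_affine a1 c)
  have a3 (z) (c : ℝ) : F 2 (z + c • m 1) = F 2 z + c * F 1 (m 1) :=
    (h2 _).unique ((h2 z).add_smul_base (posHom_of_hasDirDeriv h1) c)
  let b := basisOfLinearIndependentOfCardEqFinrank hm (by simp)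
  let L : EuclideanSpace ℝ (Fin 2) →ₗ[ℝ] ℝ := b.constr ℝ ![F 0 (m 0), F 1 (m 1)]
  refine ⟨(InnerProductSpace.toDual ℝ _).symm L.toContinuousLinearMap, fun d => ?_⟩
  rw [InnerProductSpace.toDual_symm_apply, LinearMap.coe_toContinuousLinearMap']
  have hd : d = 0 + b.repr d 0 • m 0 + b.repr d 1 • m 1 := by
    conv_lhs => rw [← b.sum_repr d]
    simp [b, Fin.sum_univ_two]
  conv_lhs => rw [hd]
  rw [a3, a2, zero_of_hasDirDeriv h2, zero_add]
  simp [L, Module.Basis.constr_apply_fintype, Fin.sum_univ_two]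

/-- The directional derivative of `f'(x; ·)` at `m` in an independent direction `d` is attained
by a lexicographic subgradient. -/
theorem LexSmoothAt.exists_mem_lexSubdifferential (h : LexSmoothAt f x)
    {φ : EuclideanSpace ℝ (Fin 2) → ℝ} (hφ : ∀ d, HasDirDeriv f x d (φ d))
    {m d : EuclideanSpace ℝ (Fin 2)} (hm : LinearIndependent ℝ ![m, d]) :
    ∃ s ∈ lexSubdifferential f x, HasDirDeriv φ m d (inner ℝ s d) := by
  obtain ⟨F, hF⟩ := h.2 ![m, d]
  obtain ⟨s, hs⟩ := hF.exists_inner hm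
  refine ⟨s, ⟨_, hm, F, hF, hs⟩, ?_⟩
  have h1 : ∀ v, HasDirDeriv (F 0) m v (F 1 v) := hF.2 0
  have h2 : ∀ v, HasDirDeriv (F 1) d v (F 2 v) := hF.2 1
  have h0 : F 0 = φ := funext fun v => (hF.1 v).unique (hφ v)
  -- With second direction `d`, homogeneity of `F 1` gives `F 2 d = [F 1]'(d; d) = F 1 d`.
  rw [← hs, (h2 d).unique (.self_dir (posHom_of_hasDirDeriv h1)), ← h0]
  exact h1 d

theorem exists_linearIndependent_pair {d : EuclideanSpace ℝ (Fin 2)} (hd : d ≠ 0) :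
    ∃ v, LinearIndependent ℝ ![v, d] := by
  obtain ⟨v, hv⟩ := exists_linearIndependent_pair_of_one_lt_finrank
    (R := ℝ) (M := EuclideanSpace ℝ (Fin 2)) (by simp) hd
  exact ⟨v, LinearIndependent.pair_symm_iff.1 hv⟩

theorem LexSmoothAt.lexSubdifferential_nonempty (h : LexSmoothAt f x) :
    (lexSubdifferential f x).Nonempty := by
  choose φ hφ using h.1
  obtain ⟨v, hv⟩ := exists_linearIndependent_pair (d := EuclideanSpace.single 0 1) (by simp)
  obtain ⟨s, hs, -⟩ := h.exists_mem_lexSubdifferential hφ hv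
  exact ⟨s, hs⟩

theorem LexSmoothAt.dirDeriv_sub_le (h : LexSmoothAt f x) {φ : EuclideanSpace ℝ (Fin 2) → ℝ}
    (hφ : ∀ d, HasDirDeriv f x d (φ d)) (hcont : Continuous φ)
    {d : EuclideanSpace ℝ (Fin 2)} (hd : d ≠ 0) {C : ℝ}
    (hC : ∀ s ∈ lexSubdifferential f x, inner ℝ s d ≤ C) (y : EuclideanSpace ℝ (Fin 2)) :
    φ (y + d) - φ y ≤ C := by
  have main (y : EuclideanSpace ℝ (Fin 2)) (hy : LinearIndependent ℝ ![y, d]) :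
      φ (y + d) - φ y ≤ C := by
    refine HasDirDeriv.image_sub_le hcont fun t => ?_
    have ht : LinearIndependent ℝ ![y + t • d, d] := by
      simpa using hy
    obtain ⟨s, hs, h'⟩ := h.exists_mem_lexSubdifferential hφ ht
    exact ⟨_, h', hC s hs⟩
  by_cases hy : LinearIndependent ℝ ![y, d]
  · exact main y hy
  obtain ⟨v, hv⟩ := exists_linearIndependent_pair hd
  obtain ⟨c, rfl⟩ : ∃ c : ℝ, y = c • d := by
    rw [LinearIndependent.pair_symm_iff, LinearIndependent.pair_iff' hd] at hy
    push Not at hy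
    exact hy.imp fun _ => Eq.symm
  -- For `y` parallel to `d`, the line through `y` meets the origin. Shift it off by `s • v` and use
  -- continuity of `φ`.
  have hlim : Tendsto (fun s : ℝ => φ (c • d + s • v + d) - φ (c • d + s • v)) (𝓝[>] 0)
      (𝓝 (φ (c • d + d) - φ (c • d))) :=
    ((hcont.tendsto _).comp ((tendsto_add_smul_nhdsGT (c • d) v).add_const d)).sub
      ((hcont.tendsto _).comp (tendsto_add_smul_nhdsGT (c • d) v))
  refine le_of_tendsto hlim ?_
  filter_upwards [self_mem_nhdsWithin] with s (hs : 0 < s)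
  refine main _ ?_
  rw [add_comm, LinearIndependent.pair_add_smul_left_iff]
  simpa using (LinearIndependent.pair_smul_smul_iff hs.ne'.isUnit isUnit_one).2 hv

end Plane

theorem mainTheorem1 (X : Set (EuclideanSpace ℝ (Fin 2))) (hX : IsOpen X)
    (f : EuclideanSpace ℝ (Fin 2) → ℝ) (hf : LocallyLipschitzOn X f)
    (x : EuclideanSpace ℝ (Fin 2)) (hx : x ∈ X) :
    (DirDifferentiableAt f x → compassDifference f x ∈ clarkeGradient f x) ∧
      (LexSmoothAt f x →
        compassDifference f x ∈ closedConvexHull ℝ (lexSubdifferential f x) ∧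
          closedConvexHull ℝ (lexSubdifferential f x) ⊆ clarkeGradient f x) := by
  obtain ⟨K, u, hu, hK⟩ := hf hx
  rw [hX.nhdsWithin_eq hx] at hu
  refine ⟨fun h d => ?_, fun h => ⟨?_, ?_⟩⟩
  · choose φ hφ using h
    refine inner_compassDifference_le hφ fun y => ?_
    simpa using dirDeriv_sub_le_clarkeDirDeriv hu hK hφ y d one_pos
  · choose φ hφ using h.1
    by_contra hnot
    obtain ⟨g, c, hg, hc⟩ := geometric_hahn_banach_closed_point convex_closedConvexHull
      isClosed_closedConvexHull hnot
    obtain ⟨d, rfl⟩ := (InnerProductSpace.toDual ℝ _).surjective g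
    simp only [InnerProductSpace.toDual_apply_apply, real_inner_comm _ d] at hg hc
    have hle : ∀ s ∈ lexSubdifferential f x, inner ℝ s d ≤ c :=
      fun s hs => (hg s (subset_closedConvexHull hs)).le
    -- For `d = 0`, separation gives `c < 0`, while any lexicographic subgradient gives `0 ≤ c`.
    rcases eq_or_ne d 0 with rfl | hd
    · obtain ⟨s, hs⟩ := h.lexSubdifferential_nonempty
      have := hle s hs
      simp only [inner_zero_right] at this hc
      linarith
    · exact hc.not_ge (inner_compassDifference_le hφ
        (h.dirDeriv_sub_le hφ (continuous_of_hasDirDeriv hu hK hφ) hd hle))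
  · exact closedConvexHull_min (lexSubdifferential_subset_clarkeGradient hu hK)
      convex_clarkeGradient isClosed_clarkeGradient
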